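/- Let $(R,\mathfrak m,k)$ be a Cohen–Macaulay (commutative Noetherian) local ring of Krull dimension $d\ge 0$ with a canonical module $\omega$, i.e. a maximal Cohen–Macaulay $R$-module of finite injective dimension and of type one ($\operatorname{Ext}^d_R(k,\omega)\cong k$). A finitely generated $R$-module $M$ is called a $d$-th syzygy if there is an exact sequence $0\to M\to P_1\to P_2\to\cdots\to P_d$ of $R$-modules in which each $P_i$ is a direct summand of a finite direct sum of copies of $R$ (for $d=0$ there is no condition). Then the following conditions are equivalent: 1. $R$ satisfies $(G_{d-1}^R)$: for every prime ideal $\mathfrak p$ of $R$ of height at most $d-1$, the ring $R_{\mathfrak p}$ has finite injective dimension as a module over itself (i.e. $R_{\mathfrak p}$ is Gorenstein); 2. every maximal Cohen–Macaulay $R$-module (nonzero finitely generated $M$ with $\operatorname{depth} M=d$) is a $d$-th syzygy; 3. $\omega$ is a $d$-th syzygy. -/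

import Mathlib

open CategoryTheory

universe u

namespace CMSyzygy

section Local

variable (R : Type u) [CommRing R] [IsLocalRing R]
variable (M : Type u) [AddCommGroup M] [Module R M]

/-- The depth of a (nonzero, finitely generated) module `M` over a local ring `R`: the supremum of
the lengths of the `M`-regular sequences of elements of the maximal ideal. -/
noncomputable def depth : ℕ∞ :=
  ⨆ (rs : List R) (_ : (∀ r ∈ rs, r ∈ IsLocalRing.maximalIdeal R) ∧
    RingTheory.Sequence.IsRegular M rs), (rs.length : ℕ∞)

/-- A maximal Cohen-Macaulay module over a local ring `R`: a nonzero finitely generated module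
whose depth is the Krull dimension of `R`. -/
structure IsMaximalCohenMacaulay : Prop where
  finite : Module.Finite R M
  nontrivial : Nontrivial M
  depth_eq : (depth R M : WithBot ℕ∞) = ringKrullDim R

/-- A Cohen-Macaulay local ring: a Noetherian local ring whose depth is its Krull dimension. -/
structure IsCohenMacaulayLocalRing : Prop where
  isNoetherianRing : IsNoetherianRing R
  depth_eq : (depth R R : WithBot ℕ∞) = ringKrullDim R

/-- `M` has type one: for `n = depth M`, the space `Ext^n(k, M)` is one-dimensional over the
residue field `k`, that is, it is isomorphic to `k`. -/
def HasTypeOne : Prop :=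
  ∃ n : ℕ, depth R M = n ∧
    Nonempty (Abelian.Ext (ModuleCat.of R (IsLocalRing.ResidueField R)) (ModuleCat.of R M) n
      ≃ₗ[R] IsLocalRing.ResidueField R)

end Local

section General

variable (R : Type u) [CommRing R] (M : Type u) [AddCommGroup M] [Module R M]

/-- `M` has finite injective dimension over `R`. -/
def HasFiniteInjectiveDimension : Prop :=
  ∃ n : ℕ, HasInjectiveDimensionLE (ModuleCat.of R M) n

/-- A canonical module of a Cohen-Macaulay local ring `R`: a maximal Cohen-Macaulay module of type
one and of finite injective dimension. -/
structure IsCanonicalModule [IsLocalRing R] : Prop where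
  isMaximalCohenMacaulay : IsMaximalCohenMacaulay R M
  hasTypeOne : HasTypeOne R M
  hasFiniteInjectiveDimension : HasFiniteInjectiveDimension R M

/-- The condition `(G_n^C)`: for every prime ideal `p` of height at most `n`, the
`R_p`-module `C_p` has finite injective dimension. The index `n` is an integer so that `n = -1`
makes sense (there the condition is empty). -/
def SatisfiesG (C : Type u) [AddCommGroup C] [Module R C] (n : ℤ) : Prop :=
  ∀ (p : Ideal R) [p.IsPrime], (∃ h : ℕ, p.height = h ∧ (h : ℤ) ≤ n) →
    HasFiniteInjectiveDimension (Localization.AtPrime p) (LocalizedModule p.primeCompl C)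

/-- `P` is a direct summand of a finite direct sum of copies of `C`. -/
def IsSummandOfFiniteSum (C P : Type u) [AddCommGroup C] [Module R C]
    [AddCommGroup P] [Module R P] : Prop :=
  ∃ (m : ℕ) (i : P →ₗ[R] (Fin m → C)) (s : (Fin m → C) →ₗ[R] P), s ∘ₗ i = LinearMap.id

/-- `M` is an `n`-`C`-syzygy: there is an exact sequence `0 → M → P₁ → P₂ → ⋯ → Pₙ` in which each
`Pᵢ` is a direct summand of a finite direct sum of copies of `C`. Here `X 0` is (a copy of) `M` and
`X i` is `Pᵢ` for `1 ≤ i ≤ n`; the terms and maps beyond `X n` carry no condition. -/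
def IsCSyzygy (C : Type u) [AddCommGroup C] [Module R C] (n : ℕ) : Prop :=
  ∃ (X : ℕ → ModuleCat.{u} R) (f : ∀ i, X i →ₗ[R] X (i + 1)),
    Nonempty (M ≃ₗ[R] X 0) ∧
    (∀ i, 1 ≤ i → i ≤ n → IsSummandOfFiniteSum R C (X i)) ∧
    (1 ≤ n → Function.Injective (f 0)) ∧
    (∀ i, i + 2 ≤ n → Function.Exact (f i) (f (i + 1)))

/-- `M` is an `n`-th syzygy: the case `C = R`, so that the `Pᵢ` are the finitely generated
projective `R`-modules. -/
def IsSyzygy (n : ℕ) : Prop := IsCSyzygy R M R n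

end General

end CMSyzygy

/-!
**From the Gorenstein condition to syzygies.** Over a Cohen-Macaulay ring a maximal `R`-regular
sequence in a prime `p` is regular on every maximal Cohen-Macaulay module `M`, and its length bounds
the injective dimension of `R_p` as soon as this is finite; hence `Ext^i(M_p, R_p) = 0` for `i > 0`.
A family of generators of `Hom(M, R)` gives a map `f : M → R^n` along which all maps `M → R` extend.
If `M` has positive depth, `f` is injective: an associated prime `p` of `ker f` is not maximal, and
then some map `M_p → R_p` does not vanish on `(ker f)_p`, although it extends along `f_p`. Since
`f_p` is an approximation too, the cokernel of `f` is again locally `Ext(-, R)`-acyclic, and its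
depth drops by at most one, so the construction can be repeated `d` times.

**From syzygies to the Gorenstein condition.** Let `T` be a maximal Cohen-Macaulay `d`-th syzygy of
finite injective dimension, embedded in a projective `P` with a `(d - 1)`-st syzygy `C` as cokernel.
Dimension shifting moves `Ext^1(C, T)` into some `Ext^d(-, T)`, which is `s`-power torsion for every
`s` in the maximal ideal. Inverting such an `s` outside `p` therefore splits `T → P`, so `T_p` is
projective, and it is nonzero because `T` is faithful. Hence `R_p` is a direct summand of `T_p`.
-/

namespace CMSyzygy

open Abelian IsLocalRing

section ExtVanishing

/-- The module `Ext^i_R(N, T)`, for unbundled `R`-modules `N` and `T`. -/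
abbrev ExtModule (R : Type u) [CommRing R] (N T : Type u) [AddCommGroup N] [Module R N]
    [AddCommGroup T] [Module R T] (i : ℕ) : Type u :=
  Ext (ModuleCat.of R N) (ModuleCat.of R T) i

/-- The vanishing of `Ext^i_R(N, T)`. -/
abbrev ExtVanishes (R : Type u) [CommRing R] (N T : Type u) [AddCommGroup N] [Module R N]
    [AddCommGroup T] [Module R T] (i : ℕ) : Prop :=
  Subsingleton (ExtModule R N T i)

/-- A linear map `f : A → B` is a left `T`-approximation of `A` if every linear map `A → T` extends
along `f`. Only this extension property is recorded; that `B` is built from copies of `T` is not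
part of the definition. -/
def IsLeftApproximation {R : Type u} [CommRing R] {A B : Type u} [AddCommGroup A] [Module R A]
    [AddCommGroup B] [Module R B] (f : A →ₗ[R] B) (T : Type u) [AddCommGroup T] [Module R T] :
    Prop :=
  ∀ φ : A →ₗ[R] T, ∃ ψ : B →ₗ[R] T, ψ ∘ₗ f = φ

variable {R : Type u} [CommRing R]
  {A B C N T X : Type u} [AddCommGroup A] [Module R A] [AddCommGroup B] [Module R B]
  [AddCommGroup C] [Module R C] [AddCommGroup N] [Module R N] [AddCommGroup T] [Module R T]
  [AddCommGroup X] [Module R X]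

/-- The map `Ext^i(B, T) → Ext^i(A, T)` induced by a linear map `A → B`. -/
noncomputable def extMap (f : A →ₗ[R] B) (T : Type u) [AddCommGroup T] [Module R T] (i : ℕ) :
    ExtModule R B T i →ₗ[R] ExtModule R A T i :=
  (Ext.mk₀ (ModuleCat.ofHom f)).precompOfLinear R _ (zero_add i)

lemma extMap_apply (f : A →ₗ[R] B) (i : ℕ) (x : ExtModule R B T i) :
    extMap f T i x = (Ext.mk₀ (ModuleCat.ofHom f)).comp x (zero_add i) := rfl

lemma extMap_comp (f : A →ₗ[R] B) (g : B →ₗ[R] C) (i : ℕ) :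
    extMap (g ∘ₗ f) T i = extMap f T i ∘ₗ extMap g T i := by
  ext x
  simp only [LinearMap.comp_apply, extMap_apply, Ext.mk₀_comp_mk₀_assoc, ModuleCat.ofHom_comp]

lemma extMap_smul_id (r : R) (i : ℕ) :
    extMap (r • (LinearMap.id : A →ₗ[R] A)) T i = r • LinearMap.id := by
  ext x
  have : ModuleCat.ofHom (r • (LinearMap.id : A →ₗ[R] A)) = r • 𝟙 (ModuleCat.of R A) := rfl
  rw [extMap_apply, this, Ext.mk₀_smul, Ext.smul_comp, Ext.mk₀_id_comp]
  rfl

lemma extMap_zero (i : ℕ) : extMap (0 : A →ₗ[R] B) T i = 0 := by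
  ext x
  have : ModuleCat.ofHom (0 : A →ₗ[R] B) = 0 := rfl
  rw [extMap_apply, this, Ext.mk₀_zero, Ext.zero_comp, LinearMap.zero_apply]

lemma extMap_mk₀ (f : A →ₗ[R] B) (ψ : B →ₗ[R] T) :
    extMap f T 0 (Ext.mk₀ (ModuleCat.ofHom ψ)) = Ext.mk₀ (ModuleCat.ofHom (ψ ∘ₗ f)) := by
  rw [extMap_apply, Ext.mk₀_comp_mk₀, ← ModuleCat.ofHom_comp]

lemma exists_eq_mk₀ (x : ExtModule R N T 0) :
    ∃ φ : N →ₗ[R] T, x = Ext.mk₀ (ModuleCat.ofHom φ) := by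
  obtain ⟨φ, rfl⟩ := Ext.homEquiv₀.symm.surjective x
  exact ⟨φ.hom, rfl⟩

lemma mk₀_ofHom_injective :
    Function.Injective fun φ : N →ₗ[R] T ↦ (Ext.mk₀ (ModuleCat.ofHom φ) : ExtModule R N T 0) :=
  (Ext.mk₀_bijective _ _).1.comp (fun _ _ h ↦ congrArg ModuleCat.Hom.hom h)

lemma extMap_zero_injective {g : B →ₗ[R] C} (hg : Function.Surjective g) :
    Function.Injective (extMap g T 0) := by
  intro x y hxy
  obtain ⟨φ, rfl⟩ := exists_eq_mk₀ x
  obtain ⟨ψ, rfl⟩ := exists_eq_mk₀ y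
  rw [extMap_mk₀, extMap_mk₀] at hxy
  rw [(LinearMap.cancel_right hg).mp (mk₀_ofHom_injective hxy)]

lemma extVanishes_zero_iff : ExtVanishes R N T 0 ↔ Subsingleton (N →ₗ[R] T) :=
  (Ext.linearEquiv₀ (R := R).trans ModuleCat.homLinearEquiv).toEquiv.subsingleton_congr

section LongExactSequence

variable {f : A →ₗ[R] B} {g : B →ₗ[R] C} (h : Function.Exact f g)
    (hf : Function.Injective f) (hg : Function.Surjective g)

include h hf hg

lemma shortExact_of_exact :
    (ModuleCat.shortComplexOfCompEqZero f g h.linearMap_comp_eq_zero).ShortExact :=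
  ModuleCat.shortComplex_shortExact _ h hf hg

lemma extMap_injective_of_extVanishes_left {i : ℕ} (hA : ExtVanishes R A T i) :
    Function.Injective (extMap g T (i + 1)) := by
  refine (injective_iff_map_eq_zero _).mpr fun x hx ↦ ?_
  obtain ⟨y, rfl⟩ := Ext.contravariant_sequence_exact₃ (shortExact_of_exact h hf hg)
    (ModuleCat.of R T) x hx (add_comm 1 i)
  rw [hA.elim y 0, Ext.comp_zero]

lemma extMap_injective_of_extVanishes_right {i : ℕ} (hC : ExtVanishes R C T i) :
    Function.Injective (extMap f T i) := by
  refine (injective_iff_map_eq_zero _).mpr fun x hx ↦ ?_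
  obtain ⟨y, rfl⟩ := Ext.contravariant_sequence_exact₂ (shortExact_of_exact h hf hg)
    (ModuleCat.of R T) x hx
  rw [hC.elim y 0, Ext.comp_zero]

lemma exists_extMap_eq_smul {r : R} {i : ℕ} (hC : ∀ y : ExtModule R C T (i + 1), r • y = 0)
    (x : ExtModule R A T i) : ∃ y, extMap f T i y = r • x :=
  Ext.contravariant_sequence_exact₁ (shortExact_of_exact h hf hg)
    (ModuleCat.of R T) (r • x) (add_comm 1 i) (by rw [Ext.comp_smul]; exact hC _)

lemma extMap_surjective {i : ℕ} (hC : ExtVanishes R C T (i + 1)) :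
    Function.Surjective (extMap f T i) := fun x ↦ by
  simpa only [one_smul] using exists_extMap_eq_smul h hf hg (r := 1) (fun y ↦ hC.elim _ _) x

lemma ExtVanishes.of_exact_middle {i : ℕ} (hA : ExtVanishes R A T i) (hC : ExtVanishes R C T i) :
    ExtVanishes R B T i :=
  ⟨fun _ _ ↦ extMap_injective_of_extVanishes_right h hf hg hC (hA.elim _ _)⟩

lemma ExtVanishes.of_exact_left {i : ℕ} (hB : ExtVanishes R B T i)
    (hC : ExtVanishes R C T (i + 1)) : ExtVanishes R A T i :=
  ⟨(extMap_surjective h hf hg hC).forall₂.mpr fun _ _ ↦ congrArg _ (hB.elim _ _)⟩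

lemma ExtVanishes.of_exact_right {i : ℕ} (hA : ExtVanishes R A T i)
    (hB : ExtVanishes R B T (i + 1)) : ExtVanishes R C T (i + 1) :=
  ⟨fun _ _ ↦ extMap_injective_of_extVanishes_left h hf hg hA (hB.elim _ _)⟩

lemma smul_ext_eq_zero_of_exact {r : R} {i : ℕ} (hB : ExtVanishes R B T i)
    (hC : ∀ y : ExtModule R C T (i + 1), r • y = 0) (x : ExtModule R A T i) : r • x = 0 := by
  obtain ⟨y, hy⟩ := exists_extMap_eq_smul h hf hg hC x
  rw [← hy, hB.elim y 0, map_zero]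

lemma exists_comp_eq_smul {r : R} (hC : ∀ y : ExtModule R C T 1, r • y = 0) (φ : A →ₗ[R] T) :
    ∃ ψ : B →ₗ[R] T, ψ ∘ₗ f = r • φ := by
  obtain ⟨y, hy⟩ := exists_extMap_eq_smul h hf hg hC (Ext.mk₀ (ModuleCat.ofHom φ))
  obtain ⟨ψ, rfl⟩ := exists_eq_mk₀ y
  rw [extMap_mk₀, ← Ext.mk₀_smul] at hy
  exact ⟨ψ, mk₀_ofHom_injective hy⟩

lemma ExtVanishes.one_of_isLeftApproximation (hB : ExtVanishes R B T 1)
    (hfT : IsLeftApproximation f T) : ExtVanishes R C T 1 := by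
  have hS := shortExact_of_exact h hf hg
  refine subsingleton_of_forall_eq 0 fun x ↦ ?_
  obtain ⟨y, rfl⟩ := Ext.contravariant_sequence_exact₃ hS
    (ModuleCat.of R T) x (hB.elim _ _) (add_comm 1 0)
  obtain ⟨φ, rfl⟩ := exists_eq_mk₀ y
  obtain ⟨ψ, rfl⟩ := hfT φ
  rw [ModuleCat.ofHom_comp, ← Ext.mk₀_comp_mk₀]
  exact hS.extClass_comp_assoc _

lemma ExtVanishes.of_exact_covariant_middle {i : ℕ} (hA : ExtVanishes R X A i)
    (hC : ExtVanishes R X C i) : ExtVanishes R X B i := by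
  refine subsingleton_of_forall_eq 0 fun x ↦ ?_
  obtain ⟨y, rfl⟩ := Ext.covariant_sequence_exact₂ (ModuleCat.of R X)
    (shortExact_of_exact h hf hg) x (hC.elim _ _)
  rw [hA.elim y 0, Ext.zero_comp]

lemma ExtVanishes.of_exact_covariant_right {i : ℕ} (hB : ExtVanishes R X B i)
    (hA : ExtVanishes R X A (i + 1)) : ExtVanishes R X C i := by
  refine subsingleton_of_forall_eq 0 fun x ↦ ?_
  obtain ⟨y, rfl⟩ := Ext.covariant_sequence_exact₃ (ModuleCat.of R X)
    (shortExact_of_exact h hf hg) x rfl (hA.elim _ _)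
  rw [hB.elim y 0, Ext.zero_comp]

end LongExactSequence

lemma smul_ext_eq_zero_of_mem_annihilator_left {r : R} (hr : r ∈ Module.annihilator R N) {i : ℕ}
    (x : ExtModule R N T i) : r • x = 0 := by
  have h0 : r • (LinearMap.id : N →ₗ[R] N) = 0 := LinearMap.ext (Module.mem_annihilator.mp hr)
  calc r • x = extMap (r • LinearMap.id) T i x := by rw [extMap_smul_id]; rfl
    _ = 0 := by rw [h0, extMap_zero, LinearMap.zero_apply]

lemma smul_ext_eq_zero_of_mem_annihilator_right {r : R} (hr : r ∈ Module.annihilator R T) {i : ℕ}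
    (x : ExtModule R N T i) : r • x = 0 := by
  have : r • 𝟙 (ModuleCat.of R T) = 0 := by
    ext t
    exact Module.mem_annihilator.mp hr t
  rw [Ext.smul_eq_comp_mk₀, this, Ext.mk₀_zero, Ext.comp_zero]

lemma ExtVanishes.of_subsingleton_left [Subsingleton N] {i : ℕ} : ExtVanishes R N T i :=
  subsingleton_of_forall_eq 0 fun x ↦ by
    rw [← one_smul R x, smul_ext_eq_zero_of_mem_annihilator_left
      (Module.mem_annihilator.mpr fun _ ↦ Subsingleton.elim _ _)]

lemma ExtVanishes.of_subsingleton_right [Subsingleton T] {i : ℕ} : ExtVanishes R N T i :=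
  subsingleton_of_forall_eq 0 fun x ↦ by
    rw [← one_smul R x, smul_ext_eq_zero_of_mem_annihilator_right
      (Module.mem_annihilator.mpr fun _ ↦ Subsingleton.elim _ _)]

lemma ExtVanishes.congr_left (e : A ≃ₗ[R] B) {i : ℕ} (h : ExtVanishes R A T i) :
    ExtVanishes R B T i :=
  have he : Function.Exact e (0 : B →ₗ[R] PUnit.{u + 1}) :=
    (LinearMap.exact_zero_iff_surjective _ e.toLinearMap).mpr e.surjective
  .of_exact_middle he e.injective (Function.surjective_to_subsingleton _) h .of_subsingleton_left

lemma ExtVanishes.congr_right (e : A ≃ₗ[R] B) {i : ℕ} (h : ExtVanishes R N A i) :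
    ExtVanishes R N B i :=
  have he : Function.Exact e (0 : B →ₗ[R] PUnit.{u + 1}) :=
    (LinearMap.exact_zero_iff_surjective _ e.toLinearMap).mpr e.surjective
  .of_exact_covariant_middle he e.injective (Function.surjective_to_subsingleton _) h
    .of_subsingleton_right

lemma ExtVanishes.of_projective [Module.Projective R N] {i : ℕ} :
    ExtVanishes R N T (i + 1) :=
  have : Projective (ModuleCat.of R N) := (IsProjective.iff_projective N).mp inferInstance
  Ext.subsingleton_of_projective _ _ _

end ExtVanishing

section InjectiveDimension

open Pointwise RingTheory.Sequence

/-- The Ext-theoretic form of `T` having injective dimension at most `n`: for every finitely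
generated module `L` and all `i > n`, `Ext^i(L, T)` vanishes. -/
def FgInjDimLE (R : Type u) [CommRing R] (T : Type u) [AddCommGroup T] [Module R T] (n : ℕ) :
    Prop :=
  ∀ (L : Type u) [AddCommGroup L] [Module R L] [Module.Finite R L] (i : ℕ), n < i →
    ExtVanishes R L T i

variable {R : Type u} [CommRing R] {M N T : Type u} [AddCommGroup M] [Module R M]
  [AddCommGroup N] [Module R N] [AddCommGroup T] [Module R T]

lemma HasFiniteInjectiveDimension.exists_fgInjDimLE (h : HasFiniteInjectiveDimension R T) :
    ∃ n, FgInjDimLE R T n := by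
  obtain ⟨n, hn⟩ := h
  exact ⟨n, fun L _ _ _ i hi ↦ HasInjectiveDimensionLT.subsingleton _ (n + 1) i hi _⟩

lemma ExtVanishes.quotient_of_isWeaklyRegular {rs : List R} (hreg : IsWeaklyRegular M rs) {c : ℕ}
    (h : ∀ i, c < i → ExtVanishes R M T i) {i : ℕ} (hi : c + rs.length < i) :
    ExtVanishes R (M ⧸ (Ideal.ofList rs • ⊤ : Submodule R M)) T i := by
  induction rs generalizing M c with
  | nil => exact (h i hi).congr_left (Submodule.quotEquivOfEqBot _ (by simp)).symm
  | cons r rs ih =>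
    rw [isWeaklyRegular_cons_iff] at hreg
    have hquot : ∀ i, c + 1 < i → ExtVanishes R (QuotSMulTop r M) T i := by
      rintro (_ | i) hi
      · omega
      · exact .of_exact_right (LinearMap.exact_lsmul_mkQ_smul_top M r) hreg.1
          (Submodule.mkQ_surjective _) (h i (by omega)) (h (i + 1) (by omega))
    refine (ih hreg.2 hquot ?_).congr_left
      (Submodule.quotOfListConsSMulTopEquivQuotSMulTopInner M r rs).symm
    rw [List.length_cons] at hi
    omega

variable [IsLocalRing R] [IsNoetherianRing R] [Module.Finite R T]

lemma ExtVanishes.of_isSMulRegular [Module.Finite R N] {x : R} (hx : x ∈ maximalIdeal R)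
    (hreg : IsSMulRegular N x) {i : ℕ} (h : ExtVanishes R (QuotSMulTop x N) T (i + 1)) :
    ExtVanishes R N T i := by
  have hsurj : Function.Surjective (extMap (LinearMap.lsmul R N x) T i) :=
    extMap_surjective (LinearMap.exact_lsmul_mkQ_smul_top N x) hreg (Submodule.mkQ_surjective _) h
  have hle : (⊤ : Submodule R (ExtModule R N T i)) ≤ maximalIdeal R • ⊤ := by
    intro y _
    obtain ⟨z, rfl⟩ := hsurj y
    have hx_id : LinearMap.lsmul R N x = x • LinearMap.id := rfl
    rw [hx_id, extMap_smul_id]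
    exact Submodule.smul_mem_smul hx trivial
  have hfin : Module.Finite R (ExtModule R N T i) := ModuleCat.finite_ext R _ _ i
  have hbot := Submodule.eq_bot_of_le_smul_of_le_jacobson_bot _ _ hfin.fg_top hle
    (maximalIdeal_le_jacobson _)
  exact (Submodule.subsingleton_iff R).mp (subsingleton_of_bot_eq_top hbot.symm)

lemma FgInjDimLE.extVanishes_of_isWeaklyRegular [Module.Finite R N] {rs : List R}
    (hmem : ∀ r ∈ rs, r ∈ maximalIdeal R) (hreg : IsWeaklyRegular N rs) {c : ℕ}
    (h : FgInjDimLE R T (c + rs.length)) {i : ℕ} (hi : c < i) : ExtVanishes R N T i := by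
  induction rs generalizing N c i with
  | nil => exact h N i hi
  | cons r rs ih =>
    rw [isWeaklyRegular_cons_iff] at hreg
    rw [List.length_cons, add_comm rs.length, ← add_assoc] at h
    exact .of_isSMulRegular (hmem r List.mem_cons_self) hreg.1
      (ih (fun s hs ↦ hmem s (List.mem_cons_of_mem r hs)) hreg.2 h (by omega))

lemma extVanishes_of_residueField {i : ℕ} (hk : ExtVanishes R (ResidueField R) T i)
    (hT : FgInjDimLE R T i) (N : Type u) [AddCommGroup N] [Module R N] [hN : Module.Finite R N] :
    ExtVanishes R N T i := by
  induction hN using IsNoetherianRing.induction_on_isQuotientEquivQuotientPrime R with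
  | subsingleton N => exact .of_subsingleton_left
  | quotient N p e =>
    by_cases hp : p.1 = maximalIdeal R
    · exact hk.congr_left
        ((Submodule.quotEquivOfEq _ _ hp.symm : (R ⧸ maximalIdeal R) ≃ₗ[R] _).trans e.symm)
    · obtain ⟨x, hx, hxp⟩ := SetLike.not_le_iff_exists.mp
        fun hle ↦ hp (le_antisymm (le_maximalIdeal p.2.ne_top) hle)
      refine .of_isSMulRegular hx ?_ (hT _ _ i.lt_succ_self)
      rw [e.isSMulRegular_congr, isSMulRegular_quotient_iff_mem_of_smul_mem]
      exact fun y hy ↦ (p.2.mem_or_mem hy).resolve_left hxp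
  | exact N₁ N₂ N₃ f g hf hg hfg h₁ h₃ => exact .of_exact_middle hfg hf hg h₁ h₃

lemma FgInjDimLE.of_extVanishes_residueField {n : ℕ} (h : FgInjDimLE R T (n + 1))
    (hk : ExtVanishes R (ResidueField R) T (n + 1)) : FgInjDimLE R T n := by
  intro L _ _ _ i hi
  obtain rfl | hi' := Nat.eq_or_lt_of_le (Nat.succ_le_of_lt hi)
  · exact extVanishes_of_residueField hk h L
  · exact h L i hi'

omit [Module.Finite R T] in
lemma exists_residueField_injective (h : maximalIdeal R ∈ associatedPrimes R N) :
    ∃ ι : ResidueField R →ₗ[R] N, Function.Injective ι :=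
  ((isAssociatedPrime_iff_exists_injective_linearMap _ _).mp h).2

omit [Module.Finite R T] in
lemma extVanishes_residueField_of_mem_associatedPrimes [Module.Finite R N]
    (hN : maximalIdeal R ∈ associatedPrimes R N) {i : ℕ} (h : ExtVanishes R N T i)
    (hT : FgInjDimLE R T i) : ExtVanishes R (ResidueField R) T i := by
  obtain ⟨ι, hι⟩ := exists_residueField_injective hN
  exact .of_exact_left ι.exact_map_mkQ_range hι (Submodule.mkQ_surjective _) h
    (hT _ _ i.lt_succ_self)

/-- Bass: for `N = R / (x₁, …, x_c)` with `x₁, …, x_c` a maximal regular sequence, this bounds the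
injective dimension by the depth of `R`. -/
lemma FgInjDimLE.of_maximalIdeal_mem_associatedPrimes [Module.Finite R N]
    (hN : maximalIdeal R ∈ associatedPrimes R N) {c n : ℕ}
    (h : ∀ i, c < i → ExtVanishes R N T i) (hT : FgInjDimLE R T n) : FgInjDimLE R T c := by
  induction n with
  | zero => exact fun L _ _ _ i hi ↦ hT L i (by omega)
  | succ n ih =>
    by_cases hn : n + 1 ≤ c
    · exact fun L _ _ _ i hi ↦ hT L i (by omega)
    · exact ih (hT.of_extVanishes_residueField
        (extVanishes_residueField_of_mem_associatedPrimes hN (h _ (by omega)) hT))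

lemma FgInjDimLE.exists_not_extVanishes_residueField [Nontrivial T] {n : ℕ}
    (h : FgInjDimLE R T n) : ∃ m, FgInjDimLE R T m ∧ ¬ ExtVanishes R (ResidueField R) T m := by
  induction n with
  | zero =>
    refine ⟨0, h, fun hk ↦ ?_⟩
    have hhom := extVanishes_zero_iff.mp (extVanishes_of_residueField hk h T)
    obtain ⟨t, ht⟩ := exists_ne (0 : T)
    exact ht congr($(hhom.elim LinearMap.id 0) t)
  | succ n ih =>
    by_cases hk : ExtVanishes R (ResidueField R) T (n + 1)
    · exact ih (h.of_extVanishes_residueField hk)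
    · exact ⟨n + 1, h, hk⟩

lemma FgInjDimLE.exists_comp_ne_zero [Nontrivial T] {n : ℕ} (h : FgInjDimLE R T n)
    [Module.Finite R N] (hN : ∀ i, 0 < i → ExtVanishes R N T i) {f : M →ₗ[R] N}
    (hf : Function.Injective f) (hM : maximalIdeal R ∈ associatedPrimes R M) :
    ∃ φ : N →ₗ[R] T, φ ∘ₗ f ≠ 0 := by
  obtain ⟨m, hm, hk⟩ := h.exists_not_extVanishes_residueField
  obtain ⟨ι, hι⟩ := exists_residueField_injective hM
  have hsurj : Function.Surjective (extMap (f ∘ₗ ι) T m) :=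
    extMap_surjective (f ∘ₗ ι).exact_map_mkQ_range (hf.comp hι) (Submodule.mkQ_surjective _)
      (hm _ _ m.lt_succ_self)
  obtain rfl | hpos := m.eq_zero_or_pos
  · by_contra! hcon
    refine hk (subsingleton_of_forall_eq 0 fun x ↦ ?_)
    obtain ⟨y, rfl⟩ := hsurj x
    obtain ⟨φ, rfl⟩ := exists_eq_mk₀ y
    rw [extMap_mk₀, ← LinearMap.comp_assoc, hcon, LinearMap.zero_comp, ModuleCat.ofHom_zero,
      Ext.mk₀_zero]
  · have := hN m hpos
    exact absurd hsurj.subsingleton hk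

end InjectiveDimension

section Depth

open Pointwise RingTheory.Sequence

/-- The Ext-theoretic form of `depth M ≥ t`: the modules `Ext^i(k, M)` vanish for all `i < t`. For
`M = 0` it holds for every `t`. -/
def DepthGE (R : Type u) [CommRing R] [IsLocalRing R] (M : Type u) [AddCommGroup M] [Module R M]
    (t : ℕ) : Prop :=
  ∀ i, i < t → ExtVanishes R (ResidueField R) M i

variable {R : Type u} [CommRing R] [IsLocalRing R] {M : Type u} [AddCommGroup M] [Module R M]

lemma DepthGE.mono {s t : ℕ} (h : DepthGE R M t) (hst : s ≤ t) : DepthGE R M s :=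
  fun i hi ↦ h i (hi.trans_le hst)

lemma DepthGE.congr {M' : Type u} [AddCommGroup M'] [Module R M'] (e : M ≃ₗ[R] M') {t : ℕ}
    (h : DepthGE R M t) : DepthGE R M' t :=
  fun i hi ↦ (h i hi).congr_right e

lemma DepthGE.of_exact_right {A B C : Type u} [AddCommGroup A] [Module R A] [AddCommGroup B]
    [Module R B] [AddCommGroup C] [Module R C] {f : A →ₗ[R] B} {g : B →ₗ[R] C}
    (h : Function.Exact f g) (hf : Function.Injective f) (hg : Function.Surjective g) {t : ℕ}
    (hA : DepthGE R A (t + 1)) (hB : DepthGE R B t) : DepthGE R C t :=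
  fun i hi ↦ .of_exact_covariant_right h hf hg (hB i hi) (hA (i + 1) (by omega))

lemma DepthGE.quotSMulTop {t : ℕ} (h : DepthGE R M (t + 1)) {x : R} (hx : IsSMulRegular M x) :
    DepthGE R (QuotSMulTop x M) t :=
  .of_exact_right (LinearMap.exact_lsmul_mkQ_smul_top M x) hx (Submodule.mkQ_surjective _) h
    (h.mono t.le_succ)

lemma DepthGE.quotient_of_isWeaklyRegular {rs : List R} (hreg : IsWeaklyRegular M rs) {t : ℕ}
    (h : DepthGE R M (t + rs.length)) :
    DepthGE R (M ⧸ (Ideal.ofList rs • ⊤ : Submodule R M)) t := by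
  induction rs generalizing M with
  | nil => exact DepthGE.congr (Submodule.quotEquivOfEqBot _ (by simp)).symm h
  | cons r rs ih =>
    rw [isWeaklyRegular_cons_iff] at hreg
    exact (ih hreg.2 (DepthGE.quotSMulTop h hreg.1)).congr
      (Submodule.quotOfListConsSMulTopEquivQuotSMulTopInner M r rs).symm

lemma DepthGE.pi {ι : Type} [Finite ι] {t : ℕ} (h : DepthGE R M t) : DepthGE R (ι → M) t := by
  refine Module.pi_induction' R (fun N _ _ ↦ DepthGE R N t) (fun N _ _ ↦ DepthGE R N t)
    (fun e h ↦ h.congr e) (fun e h ↦ h.congr e) (fun i _ ↦ .of_subsingleton_right) ?_ _ fun _ ↦ h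
  exact fun {A B} _ _ _ _ hA hB i hi ↦ .of_exact_covariant_middle (f := LinearMap.inl R A B)
    .inl_snd LinearMap.inl_injective LinearMap.snd_surjective (hA i hi) (hB i hi)

lemma maximalIdeal_smul_top_lt [Nontrivial M] [Module.Finite R M] :
    maximalIdeal R • (⊤ : Submodule R M) < ⊤ :=
  lt_top_iff_ne_top.mpr
    (Submodule.top_ne_ideal_smul_of_le_jacobson_annihilator (maximalIdeal_le_jacobson _)).symm

lemma annihilator_residueField : Module.annihilator R (ResidueField R) = maximalIdeal R :=
  Ideal.annihilator_quotient

lemma support_residueField :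
    Module.support R (ResidueField R) = PrimeSpectrum.zeroLocus (maximalIdeal R) := by
  have : Module.Finite R (ResidueField R) := inferInstance
  rw [Module.support_eq_zeroLocus, annihilator_residueField]

variable [IsNoetherianRing R]

lemma DepthGE.maximalIdeal_notMem_associatedPrimes {t : ℕ} (h : DepthGE R M (t + 1)) :
    maximalIdeal R ∉ associatedPrimes R M := fun hM ↦ by
  obtain ⟨ι, hι⟩ := exists_residueField_injective hM
  have := extVanishes_zero_iff.mp (h 0 t.succ_pos)
  refine zero_ne_one (hι ?_)
  rw [Subsingleton.elim ι 0, LinearMap.zero_apply, LinearMap.zero_apply]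

variable [Module.Finite R M]

lemma depthGE_iff_exists_isRegular [Nontrivial M] {t : ℕ} : DepthGE R M t ↔
    ∃ rs : List R, rs.length = t ∧ (∀ r ∈ rs, r ∈ maximalIdeal R) ∧ IsRegular M rs := by
  have : Module.Finite R (ModuleCat.of R (ResidueField R)) :=
    inferInstanceAs (Module.Finite R (ResidueField R))
  constructor
  · intro h
    exact ModuleCat.exists_isRegular_of_exists_subsingleton_ext (maximalIdeal R) t
      (ModuleCat.of R M) maximalIdeal_smul_top_lt (ModuleCat.of R (ResidueField R))
      support_residueField h
  · rintro ⟨rs, rfl, hmem, hreg⟩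
    exact ModuleCat.subsingleton_ext_of_exists_isRegular (maximalIdeal R)
      (ModuleCat.of R (ResidueField R)) support_residueField.le (ModuleCat.of R M)
      maximalIdeal_smul_top_lt rs hmem hreg

lemma depthGE_iff_le_depth [Nontrivial M] {t : ℕ} : DepthGE R M t ↔ (t : ℕ∞) ≤ depth R M := by
  refine ⟨fun h ↦ ?_, fun h ↦ ?_⟩
  · obtain ⟨rs, rfl, hmem, hreg⟩ := depthGE_iff_exists_isRegular.mp h
    exact le_iSup₂_of_le rs ⟨hmem, hreg⟩ le_rfl
  · obtain _ | t := t
    · exact fun i hi ↦ absurd hi i.not_lt_zero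
    obtain ⟨rs, hlt⟩ := lt_iSup_iff.mp ((ENat.natCast_lt_natCast.mpr t.lt_succ_self).trans_le h)
    obtain ⟨⟨hmem, hreg⟩, hlt⟩ := lt_iSup_iff.mp hlt
    exact (depthGE_iff_exists_isRegular.mpr ⟨rs, rfl, hmem, hreg⟩).mono
      (ENat.natCast_lt_natCast.mp hlt)

lemma DepthGE.extVanishes [Nontrivial M] {t : ℕ} (h : DepthGE R M t) {L : Type u}
    [AddCommGroup L] [Module R L] [Module.Finite R L] {n : ℕ}
    (hL : maximalIdeal R ^ n ≤ Module.annihilator R L) {i : ℕ} (hi : i < t) :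
    ExtVanishes R L M i := by
  obtain ⟨rs, rfl, hmem, hreg⟩ := depthGE_iff_exists_isRegular.mp h
  refine ModuleCat.subsingleton_ext_of_exists_isRegular (maximalIdeal R) (ModuleCat.of R L) ?_
    (ModuleCat.of R M) maximalIdeal_smul_top_lt rs hmem hreg i hi
  intro p hp
  rw [Module.support_eq_zeroLocus] at hp
  exact fun x hx ↦ p.2.mem_of_pow_mem n (hp (hL (Ideal.pow_mem_pow hx n)))

lemma DepthGE.exists_isSMulRegular {t : ℕ} (h : DepthGE R M (t + 1)) :
    ∃ x ∈ maximalIdeal R, IsSMulRegular M x := by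
  rw [← annihilator_residueField, ← IsSMulRegular.subsingleton_linearMap_iff]
  exact extVanishes_zero_iff.mp (h 0 t.succ_pos)

omit [IsLocalRing R] [Module.Finite R M] in
lemma isSMulRegular_iff_forall_notMem_associatedPrimes {x : R} :
    IsSMulRegular M x ↔ ∀ q ∈ associatedPrimes R M, x ∉ q := by
  have h := Set.ext_iff.mp (biUnion_associatedPrimes_eq_compl_regular R M) x
  simp only [Set.mem_iUnion, SetLike.mem_coe, exists_prop, Set.mem_compl_iff, Set.mem_ofPred_eq]
    at h
  rw [← not_iff_not, ← h]
  push Not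
  rfl

omit [IsLocalRing R] in
lemma exists_isSMulRegular_mem_of_forall_not_le {p : Ideal R}
    (h : ∀ q ∈ associatedPrimes R M, ¬ p ≤ q) : ∃ x ∈ p, IsSMulRegular M x := by
  by_contra! hno
  have hsub : (p : Set R) ⊆ ⋃ q ∈ associatedPrimes R M, (id q : Ideal R) := by
    simp only [id, biUnion_associatedPrimes_eq_compl_regular]
    exact hno
  obtain ⟨q, hq, hpq⟩ := (Ideal.subset_union_prime_finite (associatedPrimes.finite R M) 0 0
    fun q hq _ _ ↦ hq.isPrime).mp hsub
  exact h q hq hpq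

lemma exists_mem_notMem_smul_top {x : R} (hx : x ∈ maximalIdeal R) {N : Submodule R M}
    (hN : N ≠ ⊥) (hsat : ∀ w, x • w ∈ N → w ∈ N) : ∃ z ∈ N, z ∉ x • (⊤ : Submodule R M) := by
  by_contra! hcon
  refine hN (Submodule.eq_bot_of_le_smul_of_le_jacobson_bot _ _ (IsNoetherian.noetherian N) ?_
    (maximalIdeal_le_jacobson _))
  intro z hz
  obtain ⟨w, -, rfl⟩ := (Submodule.mem_smul_pointwise_iff_exists _ _ _).mp (hcon z hz)
  exact Submodule.smul_mem_smul hx (hsat w hz)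

lemma exists_associatedPrime_quotSMulTop {x : R} (hx : x ∈ maximalIdeal R)
    (hreg : IsSMulRegular M x) {q : Ideal R} (hq : q ∈ associatedPrimes R M) :
    ∃ q' ∈ associatedPrimes R (QuotSMulTop x M), q ≤ q' ∧ x ∈ q' := by
  obtain ⟨hqp, y, rfl⟩ := isAssociatedPrime_iff.mp hq
  let I := (⊥ : Submodule R M).colon {y}
  have hN : Submodule.torsionBySet R M I ≠ ⊥ := fun hbot ↦ by
    have hy : y ∈ Submodule.torsionBySet R M I :=
      (Submodule.mem_torsionBySet_iff _ _).mpr fun ⟨a, ha⟩ ↦ by simpa [I] using ha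
    rw [hbot, Submodule.mem_bot] at hy
    exact hqp.ne_top (by simp [hy])
  obtain ⟨z, hzN, hz⟩ := exists_mem_notMem_smul_top hx hN fun w hw ↦ by
    rw [Submodule.mem_torsionBySet_iff] at hw ⊢
    exact fun a ↦ hreg (by simpa only [smul_zero, smul_comm x] using hw a)
  obtain ⟨q', hq', hle⟩ := exists_le_isAssociatedPrime_of_isNoetherianRing R
    (Submodule.Quotient.mk z : QuotSMulTop x M) (by rwa [Ne, Submodule.Quotient.mk_eq_zero])
  refine ⟨q', hq', fun a ha ↦ hle ?_, hle ?_⟩ <;>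
    rw [Submodule.mem_colon_singleton, ← Submodule.Quotient.mk_smul, Submodule.mem_bot,
      Submodule.Quotient.mk_eq_zero]
  · rw [(Submodule.mem_torsionBySet_iff _ _).mp hzN ⟨a, ha⟩]
    exact zero_mem _
  · exact Submodule.smul_mem_pointwise_smul _ _ _ trivial

section KrullDimension

omit [IsLocalRing R] [IsNoetherianRing R]

lemma ringKrullDim_quotient_add_one_le {q q' : Ideal R} [q.IsPrime] (h : q < q') :
    ringKrullDim (R ⧸ q') + 1 ≤ ringKrullDim (R ⧸ q) := by
  obtain ⟨x, hx, hxq⟩ := SetLike.exists_of_lt h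
  refine ringKrullDim_succ_le_of_surjective (Ideal.Quotient.factor h.le)
    (Ideal.Quotient.factor_surjective h.le) (r := Ideal.Quotient.mk q x) ?_ ?_
  · rwa [mem_nonZeroDivisors_iff_ne_zero, Ne, Ideal.Quotient.eq_zero_iff_mem]
  · rwa [Ideal.Quotient.factor_mk, Ideal.Quotient.eq_zero_iff_mem]

lemma ringKrullDim_quotient_anti {q q' : Ideal R} (h : q ≤ q') :
    ringKrullDim (R ⧸ q') ≤ ringKrullDim (R ⧸ q) :=
  ringKrullDim_le_of_surjective (Ideal.Quotient.factor h) (Ideal.Quotient.factor_surjective h)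

end KrullDimension

lemma DepthGE.le_ringKrullDim_quotient {t : ℕ} (h : DepthGE R M t) {q : Ideal R}
    (hq : q ∈ associatedPrimes R M) : (t : WithBot ℕ∞) ≤ ringKrullDim (R ⧸ q) := by
  have := hq.isPrime
  induction t generalizing M q with
  | zero => exact ringKrullDim_nonneg_of_nontrivial
  | succ t ih =>
    obtain ⟨x, hx, hreg⟩ := h.exists_isSMulRegular
    obtain ⟨q', hq', hle, hxq'⟩ := exists_associatedPrime_quotSMulTop hx hreg hq
    have hxq : x ∉ q := isSMulRegular_iff_forall_notMem_associatedPrimes.mp hreg q hq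
    have hlt : q < q' := lt_of_le_of_ne hle fun heq ↦ hxq (heq ▸ hxq')
    calc ((t + 1 : ℕ) : WithBot ℕ∞) = t + 1 := by push_cast; rfl
      _ ≤ ringKrullDim (R ⧸ q') + 1 := by gcongr; exact ih (h.quotSMulTop hreg) hq' hq'.isPrime
      _ ≤ ringKrullDim (R ⧸ q) := ringKrullDim_quotient_add_one_le hlt

section CohenMacaulay

variable {d : ℕ} (hd : ringKrullDim R = d)

include hd

lemma exists_ringKrullDim_quotient_ofList {rs : List R} (hmem : ∀ r ∈ rs, r ∈ maximalIdeal R)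
    (hreg : IsWeaklyRegular R rs) :
    ∃ k : ℕ, ringKrullDim (R ⧸ Ideal.ofList rs) = k ∧ k + rs.length = d := by
  have h := ringKrullDim_add_length_eq_ringKrullDim_of_isRegular rs
    ((isRegular_iff_isWeaklyRegular_of_subset_maximalIdeal hmem).mpr hreg)
  rw [hd] at h
  generalize ringKrullDim (R ⧸ Ideal.ofList rs) = a at h
  cases a with
  | bot => simp at h
  | coe a =>
    cases a with
    | top =>
      have h' : (⊤ : ℕ∞) + rs.length = d := by exact_mod_cast h
      simp at h'
    | coe a => exact ⟨a, rfl, by exact_mod_cast h⟩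

lemma DepthGE.isWeaklyRegular (h : DepthGE R M d) {rs : List R}
    (hmem : ∀ r ∈ rs, r ∈ maximalIdeal R) (hreg : IsWeaklyRegular R rs) :
    IsWeaklyRegular M rs := by
  induction rs using List.reverseRecOn with
  | nil => exact .nil R M
  | append_singleton rs x ih =>
    have hrs := ih (fun r hr ↦ hmem r (List.mem_append_left _ hr))
      ((isWeaklyRegular_append_iff R rs [x]).mp hreg).1
    rw [isWeaklyRegular_append_iff, isWeaklyRegular_singleton_iff,
      isSMulRegular_iff_forall_notMem_associatedPrimes]
    refine ⟨hrs, fun q hq hxq ↦ ?_⟩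
    obtain ⟨k, hk, hkd⟩ := exists_ringKrullDim_quotient_ofList hd hmem hreg
    rw [List.length_append, List.length_singleton] at hkd
    have hdep : DepthGE R (M ⧸ (Ideal.ofList rs • ⊤ : Submodule R M)) (k + 1) :=
      .quotient_of_isWeaklyRegular hrs (h.mono (by omega))
    have hann : Ideal.ofList rs ≤
        Module.annihilator R (M ⧸ (Ideal.ofList rs • ⊤ : Submodule R M)) :=
      (Module.isTorsionBySet_iff_subset_annihilator _ _).mp
        (Module.isTorsionBySet_quotient_ideal_smul M (Ideal.ofList rs))
    have hle : Ideal.ofList (rs ++ [x]) ≤ q := by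
      rw [Ideal.ofList_append, Ideal.ofList_singleton, sup_le_iff, Ideal.span_singleton_le_iff_mem]
      exact ⟨hann.trans (Submodule.annihilator_top.ge.trans hq.annihilator_le), hxq⟩
    have : ((k + 1 : ℕ) : WithBot ℕ∞) ≤ k :=
      (hdep.le_ringKrullDim_quotient hq).trans ((ringKrullDim_quotient_anti hle).trans hk.le)
    exact absurd (by exact_mod_cast this) k.not_succ_le_self

lemma DepthGE.exists_isSMulRegular_mem_or_mem_associatedPrimes (h : DepthGE R R d) {p : Ideal R}
    [hp : p.IsPrime] {rs : List R} (hmem : ∀ r ∈ rs, r ∈ p) (hreg : IsWeaklyRegular R rs) :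
    (∃ x ∈ p, IsSMulRegular (R ⧸ (Ideal.ofList rs • ⊤ : Submodule R R)) x) ∨
      p ∈ associatedPrimes R (R ⧸ (Ideal.ofList rs • ⊤ : Submodule R R)) := by
  obtain ⟨k, hk, hkd⟩ := exists_ringKrullDim_quotient_ofList hd
    (fun r hr ↦ le_maximalIdeal hp.ne_top (hmem r hr)) hreg
  have hdep : DepthGE R (R ⧸ (Ideal.ofList rs • ⊤ : Submodule R R)) k :=
    .quotient_of_isWeaklyRegular hreg (h.mono (by omega))
  refine or_iff_not_imp_right.mpr fun hp ↦
    exists_isSMulRegular_mem_of_forall_not_le fun q hq hpq ↦ ?_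
  have hlt : p < q := lt_of_le_of_ne hpq fun heq ↦ hp (heq ▸ hq)
  have : (k : WithBot ℕ∞) + 1 ≤ k :=
    calc (k : WithBot ℕ∞) + 1 ≤ ringKrullDim (R ⧸ q) + 1 := by
          gcongr; exact hdep.le_ringKrullDim_quotient hq
      _ ≤ ringKrullDim (R ⧸ p) := ringKrullDim_quotient_add_one_le hlt
      _ ≤ ringKrullDim (R ⧸ Ideal.ofList rs) := ringKrullDim_quotient_anti (Ideal.span_le.mpr hmem)
      _ = k := hk
  exact absurd (by exact_mod_cast this) k.not_succ_le_self

lemma DepthGE.exists_isWeaklyRegular_mem_associatedPrimes (h : DepthGE R R d) (p : Ideal R)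
    [hp : p.IsPrime] : ∃ rs : List R, (∀ r ∈ rs, r ∈ p) ∧ IsWeaklyRegular R rs ∧
      p ∈ associatedPrimes R (R ⧸ (Ideal.ofList rs • ⊤ : Submodule R R)) := by
  by_contra! hcon
  have hlong (n : ℕ) :
      ∃ rs : List R, (∀ r ∈ rs, r ∈ p) ∧ IsWeaklyRegular R rs ∧ rs.length = n := by
    induction n with
    | zero => exact ⟨[], by simp, .nil R R, rfl⟩
    | succ n ih =>
      obtain ⟨rs, hmem, hreg, rfl⟩ := ih
      obtain ⟨x, hxp, hx⟩ := (h.exists_isSMulRegular_mem_or_mem_associatedPrimes hd hmem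
        hreg).resolve_right (hcon rs hmem hreg)
      refine ⟨rs ++ [x], ?_, ?_, List.length_append⟩
      · simpa [or_imp, forall_and] using ⟨hmem, hxp⟩
      · rw [isWeaklyRegular_append_iff, isWeaklyRegular_singleton_iff]
        exact ⟨hreg, hx⟩
  obtain ⟨rs, hmem, hreg, hlen⟩ := hlong (d + 1)
  obtain ⟨k, -, hkd⟩ := exists_ringKrullDim_quotient_ofList hd
    (fun r hr ↦ le_maximalIdeal hp.ne_top (hmem r hr)) hreg
  omega

lemma DepthGE.fgInjDimLE (h : DepthGE R R d) {n : ℕ} (hM : FgInjDimLE R M n) :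
    FgInjDimLE R M d := by
  obtain ⟨rs, hmem, hreg, hass⟩ := h.exists_isWeaklyRegular_mem_associatedPrimes hd
    (maximalIdeal R)
  obtain ⟨k, -, hkd⟩ := exists_ringKrullDim_quotient_ofList hd hmem hreg
  have hR : ∀ i, 0 < i → ExtVanishes R R M i
    | 0, h0 => absurd h0 (lt_irrefl 0)
    | _ + 1, _ => .of_projective
  exact .of_maximalIdeal_mem_associatedPrimes hass
    (fun i hi ↦ .quotient_of_isWeaklyRegular hreg hR (by omega)) hM

end CohenMacaulay

end Depth

section Syzygy

variable {R : Type u} [CommRing R] {C M P : Type u} [AddCommGroup C] [Module R C]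
  [AddCommGroup M] [Module R M] [AddCommGroup P] [Module R P]

lemma IsSummandOfFiniteSum.finite [Module.Finite R C] (h : IsSummandOfFiniteSum R C P) :
    Module.Finite R P :=
  let ⟨_, i, s, hs⟩ := h
  .of_surjective s (LinearMap.surjective_of_comp_eq_id i s hs)

lemma IsSummandOfFiniteSum.projective (h : IsSummandOfFiniteSum R R P) : Module.Projective R P :=
  let ⟨_, i, s, hs⟩ := h
  .of_split i s hs

lemma isSummandOfFiniteSum_pi (n : ℕ) : IsSummandOfFiniteSum R C (Fin n → C) :=
  ⟨n, LinearMap.id, LinearMap.id, rfl⟩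

lemma isCSyzygy_zero : IsCSyzygy R M C 0 :=
  ⟨fun _ ↦ ModuleCat.of R M, fun _ ↦ 0, ⟨.refl R M⟩, by omega, by omega, by omega⟩

lemma IsCSyzygy.succ {t : ℕ} (hP : IsSummandOfFiniteSum R C P) {f : M →ₗ[R] P}
    (hf : Function.Injective f) (h : IsCSyzygy R (P ⧸ LinearMap.range f) C t) :
    IsCSyzygy R M C (t + 1) := by
  obtain ⟨X, g, ⟨e⟩, hX, hinj, hex⟩ := h
  let q : P →ₗ[R] X 0 := e.toLinearMap ∘ₗ (LinearMap.range f).mkQ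
  have hq : Function.Surjective q := e.surjective.comp (Submodule.mkQ_surjective _)
  have hfq : Function.Exact f q :=
    (e.injective.comp_exact_iff_exact).mpr f.exact_map_mkQ_range
  refine ⟨fun | 0 => ModuleCat.of R M | 1 => ModuleCat.of R P | i + 2 => X (i + 1),
    fun | 0 => f | 1 => g 0 ∘ₗ q | i + 2 => g (i + 1),
    ⟨.refl R M⟩, ?_, fun _ ↦ hf, ?_⟩
  · rintro (_ | _ | i) h1 h2
    · omega
    · exact hP
    · exact hX (i + 1) (by omega) (by omega)
  · rintro (_ | _ | i) h1
    · exact ((hinj (by omega)).comp_exact_iff_exact).mpr hfq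
    · exact (hq.comp_exact_iff_exact).mpr (hex 0 (by omega))
    · exact hex (i + 1) (by omega)

lemma IsCSyzygy.exists_embedding {t : ℕ} (h : IsCSyzygy R M C (t + 1)) :
    ∃ (P : ModuleCat.{u} R) (f : M →ₗ[R] P), IsSummandOfFiniteSum R C P ∧
      Function.Injective f ∧ IsCSyzygy R (P ⧸ LinearMap.range f) C t := by
  obtain ⟨X, g, ⟨e⟩, hX, hinj, hex⟩ := h
  let f : M →ₗ[R] X 1 := g 0 ∘ₗ e.toLinearMap
  refine ⟨X 1, f, hX 1 le_rfl (by omega), (hinj (by omega)).comp e.injective, ?_⟩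
  obtain _ | t := t
  · exact isCSyzygy_zero
  have hfg : Function.Exact f (g 1) := LinearEquiv.precomp_exact_iff_exact.mpr (hex 0 (by omega))
  let q : (X 1 ⧸ LinearMap.range f) →ₗ[R] X 2 :=
    (LinearMap.range f).liftQ (g 1) hfg.linearMap_ker_eq.ge
  have hq : Function.Injective q :=
    LinearMap.ker_eq_bot.mp (Submodule.ker_liftQ_eq_bot _ _ _ hfg.linearMap_ker_eq.le)
  refine ⟨fun | 0 => ModuleCat.of R (X 1 ⧸ LinearMap.range f) | i + 1 => X (i + 2),
    fun | 0 => q | i + 1 => g (i + 2), ⟨.refl R _⟩, ?_, fun _ ↦ hq, ?_⟩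
  · rintro (_ | i) h1 h2
    · omega
    · exact hX (i + 2) (by omega) (by omega)
  · rintro (_ | i) h1
    · have hqg : Function.Exact (q ∘ₗ (LinearMap.range f).mkQ) (g 2) := by
        rw [Submodule.liftQ_mkQ]
        exact hex 1 (by omega)
      exact (Submodule.mkQ_surjective _).comp_exact_iff_exact.mp hqg
    · exact hex (i + 2) (by omega)

end Syzygy

section Localization

variable {R : Type u} [CommRing R] {A B C T : Type u} [AddCommGroup A] [Module R A]
  [AddCommGroup B] [Module R B] [AddCommGroup C] [Module R C] [AddCommGroup T] [Module R T]

lemma localizedModuleMap_comp (S : Submonoid R) (f : A →ₗ[R] B) (g : B →ₗ[R] C) :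
    LocalizedModule.map S (g ∘ₗ f) = LocalizedModule.map S g ∘ₗ LocalizedModule.map S f := by
  ext z
  induction z using LocalizedModule.induction_on with
  | h x s => simp only [LinearMap.comp_apply, LocalizedModule.map_mk]

lemma localizedModuleMap_exact (S : Submonoid R) {f : A →ₗ[R] B} {g : B →ₗ[R] C}
    (h : Function.Exact f g) :
    Function.Exact (LocalizedModule.map S f) (LocalizedModule.map S g) :=
  IsLocalizedModule.map_exact S _ _ _ f g h

lemma smul_mk_one_eq_one {S : Submonoid R} (s : S) : s • (Localization.mk 1 s) = 1 := by
  rw [Submonoid.smul_def, Localization.smul_mk, smul_eq_mul, mul_one, Localization.mk_self]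

lemma IsLeftApproximation.localizedModule [Module.FinitePresentation R A] (S : Submonoid R)
    {f : A →ₗ[R] B} (hf : IsLeftApproximation f T) :
    IsLeftApproximation (LocalizedModule.map S f) (LocalizedModule S T) := by
  intro φ
  obtain ⟨⟨φ, s⟩, rfl⟩ := IsLocalizedModule.mk'_surjective S (LocalizedModule.map S) φ
  obtain ⟨ψ, rfl⟩ := hf φ
  refine ⟨Localization.mk 1 s • LocalizedModule.map S ψ, ?_⟩
  rw [Function.uncurry_apply_pair, eq_comm, IsLocalizedModule.mk'_eq_iff, LinearMap.smul_comp,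
    ← localizedModuleMap_comp, ← smul_assoc, smul_mk_one_eq_one, one_smul]

lemma exists_comp_localizedModuleMap_eq_id {S : Submonoid R} {f : A →ₗ[R] B} {ψ : B →ₗ[R] A}
    {s : R} (hs : s ∈ S) (h : ψ ∘ₗ f = s • LinearMap.id) :
    ∃ ρ : LocalizedModule S B →ₗ[Localization S] LocalizedModule S A,
      ρ ∘ₗ LocalizedModule.map S f = LinearMap.id := by
  refine ⟨Localization.mk 1 ⟨s, hs⟩ • LocalizedModule.map S ψ, ?_⟩
  rw [LinearMap.smul_comp, ← localizedModuleMap_comp, h]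
  rw [map_smul, LocalizedModule.map_id, smul_comm, ← smul_assoc, ← Submonoid.mk_smul s hs,
    smul_mk_one_eq_one, one_smul]

/-- The localization of `R`, formed as a module, is the localization of `R` as a ring. -/
noncomputable def localizedModuleSelfEquiv (S : Submonoid R) :
    LocalizedModule S R ≃ₗ[Localization S] Localization S :=
  LinearEquiv.extendScalarsOfIsLocalization S _
    (IsLocalizedModule.linearEquiv S (LocalizedModule.mkLinearMap S R)
      (Algebra.linearMap R (Localization S)))

instance localizedModule_self_nontrivial (p : Ideal R) [p.IsPrime] :
    Nontrivial (LocalizedModule p.primeCompl R) :=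
  (localizedModuleSelfEquiv p.primeCompl).toEquiv.nontrivial

end Localization

section Approximation

variable {R : Type u} [CommRing R] [IsLocalRing R]

/-- A local ring is Gorenstein on the punctured spectrum if its localizations at the non-maximal
primes have finite self-injective dimension. -/
def IsGorensteinOnPuncturedSpectrum (R : Type u) [CommRing R] [IsLocalRing R] : Prop :=
  ∀ (p : Ideal R) [p.IsPrime], p ≠ maximalIdeal R →
    HasFiniteInjectiveDimension (Localization.AtPrime p) (LocalizedModule p.primeCompl R)

/-- The module `M` is `Ext(-, R)`-acyclic on the punctured spectrum of the local ring `R`. -/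
def LocallyExtVanishes (R : Type u) [CommRing R] [IsLocalRing R] (M : Type u) [AddCommGroup M]
    [Module R M] : Prop :=
  ∀ (p : Ideal R) [p.IsPrime], p ≠ maximalIdeal R → ∀ i, 0 < i →
    ExtVanishes (Localization.AtPrime p) (LocalizedModule p.primeCompl M)
      (LocalizedModule p.primeCompl R) i

variable [IsNoetherianRing R] {M : Type u} [AddCommGroup M] [Module R M] [Module.Finite R M]

omit [IsLocalRing R] in
variable (R M) in
lemma exists_isLeftApproximation :
    ∃ (n : ℕ) (f : M →ₗ[R] (Fin n → R)), IsLeftApproximation f R := by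
  obtain ⟨n, π, hπ⟩ := Module.Finite.exists_fin' R (M →ₗ[R] R)
  refine ⟨n, LinearMap.pi fun i ↦ π (Pi.single i 1), fun φ ↦ ?_⟩
  obtain ⟨c, rfl⟩ := hπ φ
  refine ⟨∑ i, c i • LinearMap.proj i, LinearMap.ext fun x ↦ ?_⟩
  conv_rhs => rw [pi_eq_sum_univ' c, map_sum]
  simp [LinearMap.sum_apply]

lemma IsLeftApproximation.injective {P : Type u} [AddCommGroup P] [Module R P] {f : M →ₗ[R] P}
    (hf : IsLeftApproximation f R) (hG : IsGorensteinOnPuncturedSpectrum R) {t : ℕ}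
    (hdep : DepthGE R M (t + 1)) (hM : LocallyExtVanishes R M) : Function.Injective f := by
  rw [← LinearMap.ker_eq_bot]
  by_contra hker
  have : Nontrivial (LinearMap.ker f) := Submodule.nontrivial_iff_ne_bot.mpr hker
  have := Module.finitePresentation_of_finite R M
  obtain ⟨p, hp⟩ := associatedPrimes.nonempty R (LinearMap.ker f)
  have : p.IsPrime := hp.isPrime
  obtain rfl | hpm := eq_or_ne p (maximalIdeal R)
  · exact hdep.maximalIdeal_notMem_associatedPrimes
      (associatedPrimes.subset_of_injective (Submodule.injective_subtype _) hp)
  obtain ⟨n, hn⟩ := (hG p hpm).exists_fgInjDimLE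
  obtain ⟨φ, hφ⟩ := hn.exists_comp_ne_zero (hM p hpm)
    (LocalizedModule.map_injective p.primeCompl _ (Submodule.injective_subtype _))
    (Module.associatedPrimes.mem_associatedPrimes_atPrime_of_mem_associatedPrimes hp)
  obtain ⟨ψ, rfl⟩ := hf.localizedModule p.primeCompl φ
  refine hφ ?_
  rw [LinearMap.comp_assoc, ← localizedModuleMap_comp, LinearMap.comp_ker_subtype, map_zero,
    LinearMap.comp_zero]

lemma LocallyExtVanishes.quotient (hM : LocallyExtVanishes R M) {n : ℕ} {f : M →ₗ[R] (Fin n → R)}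
    (hinj : Function.Injective f) (hf : IsLeftApproximation f R) :
    LocallyExtVanishes R ((Fin n → R) ⧸ LinearMap.range f) := by
  intro p _ hpm i hi
  have := Module.finitePresentation_of_finite R M
  have hinj' := LocalizedModule.map_injective p.primeCompl f hinj
  have hex := localizedModuleMap_exact p.primeCompl f.exact_map_mkQ_range
  have hsurj := LocalizedModule.map_surjective p.primeCompl _
    (Submodule.mkQ_surjective (LinearMap.range f))
  match i, hi with
  | 1, _ =>
    exact .one_of_isLeftApproximation hex hinj' hsurj .of_projective
      (hf.localizedModule p.primeCompl)
  | i + 2, _ =>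
    exact .of_exact_right hex hinj' hsurj (hM p hpm (i + 1) i.succ_pos) .of_projective

theorem LocallyExtVanishes.isSyzygy (hG : IsGorensteinOnPuncturedSpectrum R) {t : ℕ}
    (hR : DepthGE R R t) (hdep : DepthGE R M t) (hM : LocallyExtVanishes R M) :
    IsSyzygy R M t := by
  induction t generalizing M with
  | zero => exact isCSyzygy_zero
  | succ t ih =>
    obtain ⟨n, f, hf⟩ := exists_isLeftApproximation R M
    have hinj : Function.Injective f := hf.injective hG hdep hM
    have hR' : DepthGE R R t := hR.mono t.le_succ
    have hdep' : DepthGE R ((Fin n → R) ⧸ LinearMap.range f) t :=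
      .of_exact_right f.exact_map_mkQ_range hinj (Submodule.mkQ_surjective _) hdep hR'.pi
    exact .succ (isSummandOfFiniteSum_pi n) hinj (ih hR' hdep' (hM.quotient hinj hf))

omit [IsLocalRing R] [IsNoetherianRing R] [Module.Finite R M] in
lemma maximalIdeal_mem_associatedPrimes_localizedModule_quotient {rs : List R} {p : Ideal R}
    [p.IsPrime] (h : p ∈ associatedPrimes R (M ⧸ (Ideal.ofList rs • ⊤ : Submodule R M))) :
    maximalIdeal (Localization.AtPrime p) ∈ associatedPrimes (Localization.AtPrime p)
      (LocalizedModule p.primeCompl M ⧸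
        (Ideal.ofList (rs.map (algebraMap R (Localization.AtPrime p))) • ⊤ :
          Submodule (Localization.AtPrime p) (LocalizedModule p.primeCompl M))) := by
  let e := (localizedQuotientEquiv p.primeCompl (Ideal.ofList rs • ⊤ : Submodule R M)).symm ≪≫ₗ
    Submodule.quotEquivOfEq _
      (Ideal.ofList (rs.map (algebraMap R (Localization.AtPrime p))) • ⊤) (by
      rw [Submodule.localized, Submodule.localized'_smul, Ideal.localized'_eq_map,
        Submodule.localized'_top, Ideal.map_ofList])
  rw [← LinearEquiv.AssociatedPrimes.eq e]
  exact Module.associatedPrimes.mem_associatedPrimes_atPrime_of_mem_associatedPrimes h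

open RingTheory.Sequence in
lemma DepthGE.extVanishes_localizedModule {d : ℕ} (hM : DepthGE R M d) (hR : DepthGE R R d)
    (hd : ringKrullDim R = d) (p : Ideal R) [hp : p.IsPrime]
    (hG : HasFiniteInjectiveDimension (Localization.AtPrime p) (LocalizedModule p.primeCompl R))
    {i : ℕ} (hi : 0 < i) : ExtVanishes (Localization.AtPrime p) (LocalizedModule p.primeCompl M)
      (LocalizedModule p.primeCompl R) i := by
  obtain ⟨rs, hmem, hreg, hass⟩ := hR.exists_isWeaklyRegular_mem_associatedPrimes hd p
  let rs' := rs.map (algebraMap R (Localization.AtPrime p))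
  have hregR : IsWeaklyRegular (LocalizedModule p.primeCompl R) rs' :=
    hreg.of_isLocalizedModule _ p.primeCompl (LocalizedModule.mkLinearMap p.primeCompl R)
  have hregM : IsWeaklyRegular (LocalizedModule p.primeCompl M) rs' :=
    (hM.isWeaklyRegular hd (fun r hr ↦ le_maximalIdeal hp.ne_top (hmem r hr)) hreg)
      |>.of_isLocalizedModule _ p.primeCompl (LocalizedModule.mkLinearMap p.primeCompl M)
  have hmem' : ∀ r ∈ rs', r ∈ maximalIdeal (Localization.AtPrime p) := by
    intro _ h
    obtain ⟨r, hr, rfl⟩ := List.mem_map.mp h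
    rw [← Localization.AtPrime.map_eq_maximalIdeal]
    exact Ideal.mem_map_of_mem _ (hmem r hr)
  obtain ⟨n, hn⟩ := hG.exists_fgInjDimLE
  -- As `p` is associated to `R / rs`, the sequence `rs` bounds the injective dimension of `R_p`.
  have hdim : FgInjDimLE (Localization.AtPrime p) (LocalizedModule p.primeCompl R)
      (0 + rs'.length) :=
    .of_maximalIdeal_mem_associatedPrimes
      (maximalIdeal_mem_associatedPrimes_localizedModule_quotient hass)
      (fun j hj ↦ .quotient_of_isWeaklyRegular hregR
        (fun | _ + 1, _ => .of_projective) hj) hn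
  exact hdim.extVanishes_of_isWeaklyRegular hmem' hregM hi

end Approximation

section Torsion

variable {R : Type u} [CommRing R] [IsLocalRing R] [IsNoetherianRing R]
  {T : Type u} [AddCommGroup T] [Module R T] {N : Type u} [AddCommGroup N] [Module R N]
  [Module.Finite R N]

omit [IsLocalRing R] in
variable (R N) in
lemma exists_isSMulRegular_quotient_torsionBy_pow (s : R) :
    ∃ n : ℕ, IsSMulRegular (N ⧸ Submodule.torsionBy R N (s ^ n)) s := by
  have hmono : Monotone fun n ↦ Submodule.torsionBy R N (s ^ n) := fun m n hmn ↦
    Submodule.torsionBy_le_torsionBy_of_dvd _ _ (pow_dvd_pow s hmn)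
  obtain ⟨n, hn⟩ := monotone_stabilizes_iff_noetherian.mpr
    (inferInstance : IsNoetherian R N) ⟨_, hmono⟩
  refine ⟨n, (isSMulRegular_quotient_iff_mem_of_smul_mem _ _).mpr fun y hy ↦ ?_⟩
  have hstable : Submodule.torsionBy R N (s ^ n) = Submodule.torsionBy R N (s ^ (n + 1)) :=
    hn (n + 1) n.le_succ
  rwa [hstable, Submodule.mem_torsionBy_iff, pow_succ, mul_smul]

variable [Module.Finite R T]

lemma FgInjDimLE.exists_pow_smul_ext_eq_zero {d : ℕ} (hT : FgInjDimLE R T d) {s : R}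
    (hs : s ∈ maximalIdeal R) : ∃ t : ℕ, ∀ x : ExtModule R N T d, s ^ t • x = 0 := by
  obtain ⟨n, hreg⟩ := exists_isSMulRegular_quotient_torsionBy_pow R N s
  let K := Submodule.torsionBy R N (s ^ n)
  have hC : ExtVanishes R (N ⧸ K) T d := .of_isSMulRegular hs hreg (hT _ _ d.lt_succ_self)
  have hK : s ^ n ∈ Module.annihilator R K :=
    Module.mem_annihilator.mpr fun y ↦ Submodule.smul_torsionBy (s ^ n) y
  refine ⟨n, fun x ↦ extMap_injective_of_extVanishes_right (LinearMap.exact_subtype_mkQ K)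
    K.injective_subtype K.mkQ_surjective hC ?_⟩
  rw [map_smul, map_zero, smul_ext_eq_zero_of_mem_annihilator_left hK]

lemma FgInjDimLE.exists_pow_smul_ext_eq_zero_of_isSyzygy {d : ℕ} (hT : FgInjDimLE R T d) {s : R}
    (hs : s ∈ maximalIdeal R) {i j : ℕ} (hN : IsSyzygy R N j) (hi : 0 < i) (hij : d ≤ i + j) :
    ∃ t : ℕ, ∀ x : ExtModule R N T i, s ^ t • x = 0 := by
  induction j generalizing N i with
  | zero =>
    obtain rfl | hlt := hij.eq_or_lt
    · exact hT.exists_pow_smul_ext_eq_zero hs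
    · exact ⟨0, fun x ↦ (hT N i hlt).elim _ _⟩
  | succ j ih =>
    obtain ⟨P, f, hP, hf, hC⟩ := hN.exists_embedding
    have := hP.finite
    have := hP.projective
    obtain ⟨t, ht⟩ := ih hC (i := i + 1) i.succ_pos (by omega)
    obtain ⟨i, rfl⟩ := Nat.exists_eq_succ_of_ne_zero hi.ne'
    exact ⟨t, smul_ext_eq_zero_of_exact f.exact_map_mkQ_range hf (Submodule.mkQ_surjective _)
      .of_projective ht⟩

end Torsion

section Faithful

variable {R : Type u} [CommRing R] [IsLocalRing R] [IsNoetherianRing R]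
  {L T : Type u} [AddCommGroup L] [Module R L] [AddCommGroup T] [Module R T] [Module.Finite R T]

lemma maximalIdeal_mem_associatedPrimes_of_pow_le_annihilator [Nontrivial L] {n : ℕ}
    (hL : maximalIdeal R ^ n ≤ Module.annihilator R L) :
    maximalIdeal R ∈ associatedPrimes R L := by
  obtain ⟨p, hp⟩ := associatedPrimes.nonempty R L
  have hprime : p.IsPrime := hp.isPrime
  have hann : Module.annihilator R L ≤ p :=
    Submodule.annihilator_top.symm.le.trans hp.annihilator_le
  have hle : maximalIdeal R ≤ p := hprime.le_of_pow_le (hL.trans hann)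
  rwa [← (maximalIdeal.isMaximal R).eq_of_le hprime.ne_top hle] at hp

lemma DepthGE.extMap_injective [Nontrivial T] {d : ℕ} (hdep : DepthGE R T d) [Module.Finite R L]
    {n : ℕ} (hL : maximalIdeal R ^ n ≤ Module.annihilator R L) {Q : Type u} [AddCommGroup Q]
    [Module R Q] {g : L →ₗ[R] Q} (hg : Function.Surjective g) :
    Function.Injective (extMap g T d) := by
  obtain _ | d := d
  · exact extMap_zero_injective hg
  have hker : maximalIdeal R ^ n ≤ Module.annihilator R (LinearMap.ker g) :=
    hL.trans ((LinearMap.ker g).subtype.annihilator_le_of_injective (Submodule.injective_subtype _))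
  exact extMap_injective_of_extVanishes_left (LinearMap.exact_subtype_ker_map g)
    (Submodule.injective_subtype _) hg (hdep.extVanishes hker d.lt_succ_self)

lemma FgInjDimLE.annihilator_le [Nontrivial T] {d : ℕ} (hT : FgInjDimLE R T d)
    (hdep : DepthGE R T d) (hk : ¬ ExtVanishes R (ResidueField R) T d) [Module.Finite R L] {n : ℕ}
    (hL : maximalIdeal R ^ n ≤ Module.annihilator R L) :
    Module.annihilator R T ≤ Module.annihilator R L := by
  intro a ha
  let g : L →ₗ[R] L := a • LinearMap.id
  by_contra hne
  have : Nontrivial (LinearMap.range g) := by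
    rw [Submodule.nontrivial_iff_ne_bot, Ne, LinearMap.range_eq_bot]
    exact fun h0 ↦ hne (Module.mem_annihilator.mpr fun x ↦ congr($h0 x))
  have hrange : maximalIdeal R ∈ associatedPrimes R (LinearMap.range g) :=
    maximalIdeal_mem_associatedPrimes_of_pow_le_annihilator
      (hL.trans ((LinearMap.range g).subtype.annihilator_le_of_injective
        (Submodule.injective_subtype _)))
  refine hk (extVanishes_residueField_of_mem_associatedPrimes hrange ?_ hT)
  -- The zero map `a` on `Ext^d(L, T)` factors as a surjection onto `Ext^d(aL, T)` followed by an
  -- injection.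
  refine subsingleton_of_forall_eq 0 fun y ↦ ?_
  obtain ⟨x, rfl⟩ := extMap_surjective (LinearMap.exact_subtype_mkQ (LinearMap.range g))
    (Submodule.injective_subtype _) (Submodule.mkQ_surjective _) (hT _ _ d.lt_succ_self) y
  refine hdep.extMap_injective hL g.surjective_rangeRestrict ?_
  calc extMap g.rangeRestrict T d (extMap (LinearMap.range g).subtype T d x)
      = extMap (a • LinearMap.id) T d x := by rw [← LinearMap.comp_apply, ← extMap_comp]; rfl
    _ = a • x := by rw [extMap_smul_id]; rfl
    _ = 0 := smul_ext_eq_zero_of_mem_annihilator_right ha x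
    _ = extMap g.rangeRestrict T d 0 := (map_zero _).symm

lemma FgInjDimLE.annihilator_eq_bot [Nontrivial T] {d : ℕ} (hT : FgInjDimLE R T d)
    (hdep : DepthGE R T d) (hk : ¬ ExtVanishes R (ResidueField R) T d) :
    Module.annihilator R T = ⊥ := by
  rw [eq_bot_iff, ← Ideal.iInf_pow_eq_bot_of_isLocalRing (maximalIdeal R)
    (maximalIdeal.isMaximal R).ne_top]
  refine le_iInf fun n ↦ ?_
  have hn : Module.annihilator R (R ⧸ maximalIdeal R ^ n) = maximalIdeal R ^ n :=
    Ideal.annihilator_quotient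
  exact (hT.annihilator_le hdep hk hn.ge).trans hn.le

end Faithful

section FiniteInjectiveDimension

variable {R : Type u} [CommRing R] {A B : Type u} [AddCommGroup A] [Module R A]
  [AddCommGroup B] [Module R B]

lemma HasFiniteInjectiveDimension.of_retract (h : HasFiniteInjectiveDimension R B)
    {i : A →ₗ[R] B} {r : B →ₗ[R] A} (hr : r ∘ₗ i = LinearMap.id) :
    HasFiniteInjectiveDimension R A := by
  obtain ⟨n, hn⟩ := h
  have e : Retract (ModuleCat.of R A) (ModuleCat.of R B) :=
    { i := ModuleCat.ofHom i
      r := ModuleCat.ofHom r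
      retract := by
        rw [← ModuleCat.ofHom_comp, hr]
        rfl }
  exact ⟨n, e.hasInjectiveDimensionLT (n + 1)⟩

lemma HasFiniteInjectiveDimension.localizedModule [IsNoetherianRing R]
    (h : HasFiniteInjectiveDimension R A) (S : Submonoid R) :
    HasFiniteInjectiveDimension (Localization S) (LocalizedModule S A) := by
  obtain ⟨n, hn⟩ := h
  have := ModuleCat.localizedModule_hasInjectiveDimensionLE n S (ModuleCat.of R A)
  exact ⟨n, (ModuleCat.hasInjectiveDimensionLE_iff_of_linearEquiv
    (M := (ModuleCat.of R A).localizedModule S)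
    (N := ModuleCat.of (Localization S) (LocalizedModule S A))
    (Shrink.linearEquiv.{u} (Localization S) (LocalizedModule S A)) n).mp this⟩

lemma HasFiniteInjectiveDimension.of_projective [IsLocalRing R] [Module.Finite R A]
    [Module.Projective R A] [Nontrivial A] (h : HasFiniteInjectiveDimension R A) :
    HasFiniteInjectiveDimension R R := by
  have : Module.Free R A := Module.free_of_flat_of_isLocalRing
  let b := Module.Free.chooseBasis R A
  obtain ⟨j⟩ := b.index_nonempty
  exact h.of_retract (i := LinearMap.toSpanSingleton R A (b j)) (r := b.coord j) (by ext; simp)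

end FiniteInjectiveDimension

section Main

variable {R : Type u} [CommRing R] [IsLocalRing R]

lemma satisfiesG_sub_one_iff [IsNoetherianRing R] {d : ℕ} (hd : ringKrullDim R = d) :
    SatisfiesG R R ((d : ℤ) - 1) ↔ IsGorensteinOnPuncturedSpectrum R := by
  have hm : (maximalIdeal R).height = d :=
    WithBot.coe_inj.mp (maximalIdeal_height_eq_ringKrullDim.trans hd)
  refine forall₂_congr fun p hp ↦ imp_congr_left ⟨?_, fun hpm ↦ ?_⟩
  · rintro ⟨h, hh, hle⟩ rfl
    have : h = d := ENat.natCast_inj.mp (hh.symm.trans hm)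
    omega
  · have hlt : p.height < d := hm ▸ Ideal.height_strict_mono_of_isPrime_of_isPrime
      ((le_maximalIdeal hp.ne_top).lt_of_ne hpm)
    obtain ⟨h, hh⟩ := ENat.ne_top_iff_exists.mp hlt.ne_top
    rw [← hh, ENat.natCast_lt_natCast] at hlt
    exact ⟨h, hh.symm, by omega⟩

lemma IsCohenMacaulayLocalRing.isMaximalCohenMacaulay (h : IsCohenMacaulayLocalRing R) :
    IsMaximalCohenMacaulay R R :=
  ⟨inferInstance, inferInstance, h.depth_eq⟩

variable [IsNoetherianRing R] {M T : Type u} [AddCommGroup M] [Module R M] [AddCommGroup T]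
  [Module R T] {d : ℕ}

lemma IsMaximalCohenMacaulay.depthGE_iff (h : IsMaximalCohenMacaulay R M)
    (hd : ringKrullDim R = d) {t : ℕ} : DepthGE R M t ↔ t ≤ d := by
  have := h.finite
  have := h.nontrivial
  have hdepth : depth R M = d := WithBot.coe_inj.mp (h.depth_eq.trans hd)
  rw [depthGE_iff_le_depth, hdepth, ENat.natCast_le_natCast]

lemma IsMaximalCohenMacaulay.not_extVanishes_residueField (h : IsMaximalCohenMacaulay R M)
    (hd : ringKrullDim R = d) : ¬ ExtVanishes R (ResidueField R) M d := fun hk ↦ by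
  have hdep : DepthGE R M (d + 1) := fun i hi ↦
    (Nat.lt_succ_iff_lt_or_eq.mp hi).elim ((h.depthGE_iff hd).mpr le_rfl i) (· ▸ hk)
  exact (h.depthGE_iff hd).not.mpr (Nat.not_succ_le_self d) hdep

lemma IsMaximalCohenMacaulay.isSyzygy (hM : IsMaximalCohenMacaulay R M)
    (hR : IsMaximalCohenMacaulay R R) (hd : ringKrullDim R = d)
    (hG : IsGorensteinOnPuncturedSpectrum R) : IsSyzygy R M d := by
  have := hM.finite
  have hRd : DepthGE R R d := (hR.depthGE_iff hd).mpr le_rfl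
  have hMd : DepthGE R M d := (hM.depthGE_iff hd).mpr le_rfl
  exact LocallyExtVanishes.isSyzygy hG hRd hMd fun p _ hp i hi ↦
    hMd.extVanishes_localizedModule hRd hd p (hG p hp) hi

lemma FgInjDimLE.projective_localizedModule_of_isSyzygy [Module.Finite R T]
    (hT : FgInjDimLE R T (d + 1)) (hsyz : IsSyzygy R T (d + 1)) (p : Ideal R) [hp : p.IsPrime]
    (hpm : p ≠ maximalIdeal R) :
    Module.Projective (Localization.AtPrime p) (LocalizedModule p.primeCompl T) := by
  obtain ⟨P, f, hP, hf, hC⟩ := hsyz.exists_embedding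
  have := hP.finite
  have := hP.projective
  obtain ⟨s, hs, hsp⟩ := SetLike.not_le_iff_exists.mp fun h ↦
    hpm (((maximalIdeal.isMaximal R).eq_of_le hp.ne_top h).symm)
  obtain ⟨t, ht⟩ := hT.exists_pow_smul_ext_eq_zero_of_isSyzygy hs hC one_pos (by omega)
  obtain ⟨ψ, hψ⟩ := exists_comp_eq_smul f.exact_map_mkQ_range hf (Submodule.mkQ_surjective _) ht
    LinearMap.id
  obtain ⟨ρ, hρ⟩ := exists_comp_localizedModuleMap_eq_id (S := p.primeCompl)
    (fun h ↦ hsp (hp.mem_of_pow_mem t h)) hψ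
  exact .of_split _ _ hρ

lemma HasFiniteInjectiveDimension.isGorensteinOnPuncturedSpectrum [Module.Finite R T]
    (hT : HasFiniteInjectiveDimension R T) (hann : Module.annihilator R T = ⊥)
    (hle : FgInjDimLE R T (d + 1)) (hsyz : IsSyzygy R T (d + 1)) :
    IsGorensteinOnPuncturedSpectrum R := by
  intro p hp hpm
  have := hle.projective_localizedModule_of_isSyzygy hsyz p hpm
  have : Nontrivial (LocalizedModule p.primeCompl T) := by
    have hmem : (⟨p, hp⟩ : PrimeSpectrum R) ∈ Module.support R T := by
      simp [Module.support_eq_zeroLocus, hann]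
    exact Module.mem_support_iff.mp hmem
  exact (hT.localizedModule p.primeCompl).of_projective.of_retract
    (localizedModuleSelfEquiv p.primeCompl).symm_comp

lemma IsMaximalCohenMacaulay.isGorensteinOnPuncturedSpectrum (hT : IsMaximalCohenMacaulay R T)
    (hR : IsMaximalCohenMacaulay R R) (hd : ringKrullDim R = d)
    (hinj : HasFiniteInjectiveDimension R T) (hsyz : IsSyzygy R T d) :
    IsGorensteinOnPuncturedSpectrum R := by
  have := hT.finite
  have := hT.nontrivial
  obtain ⟨n, hn⟩ := hinj.exists_fgInjDimLE
  have hle : FgInjDimLE R T d := ((hR.depthGE_iff hd).mpr le_rfl).fgInjDimLE hd hn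
  have hann : Module.annihilator R T = ⊥ :=
    hle.annihilator_eq_bot ((hT.depthGE_iff hd).mpr le_rfl) (hT.not_extVanishes_residueField hd)
  obtain _ | d := d
  · exact (satisfiesG_sub_one_iff hd).mp fun _ _ ⟨_, _, h⟩ ↦ absurd h (by omega)
  · exact hinj.isGorensteinOnPuncturedSpectrum hann hle hsyz

end Main

end CMSyzygy

theorem corollary4p2_general (R : Type u) [CommRing R] [IsLocalRing R]
    (hR : CMSyzygy.IsCohenMacaulayLocalRing R)
    (d : ℕ) (hd : ringKrullDim R = d)
    (T : Type u) [AddCommGroup T] [Module R T] (hT : CMSyzygy.IsMaximalCohenMacaulay R T)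
    (hinj : CMSyzygy.HasFiniteInjectiveDimension R T) :
    [CMSyzygy.SatisfiesG R R ((d : ℤ) - 1),
      ∀ (M : Type u) [AddCommGroup M] [Module R M],
        CMSyzygy.IsMaximalCohenMacaulay R M → CMSyzygy.IsSyzygy R M d,
      CMSyzygy.IsSyzygy R T d].TFAE := by
  have := hR.isNoetherianRing
  have hRR := hR.isMaximalCohenMacaulay
  rw [CMSyzygy.satisfiesG_sub_one_iff hd]
  tfae_have 1 → 2 := fun hG M _ _ hM ↦ hM.isSyzygy hRR hd hG
  tfae_have 2 → 3 := fun h ↦ h T hT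
  tfae_have 3 → 1 := hT.isGorensteinOnPuncturedSpectrum hRR hd hinj
  tfae_finish

theorem corollary4p2 (R : Type u) [CommRing R] [IsLocalRing R]
    (hR : CMSyzygy.IsCohenMacaulayLocalRing R)
    (d : ℕ) (hd : ringKrullDim R = d)
    (ω : Type u) [AddCommGroup ω] [Module R ω] (hω : CMSyzygy.IsCanonicalModule R ω) :
    [CMSyzygy.SatisfiesG R R ((d : ℤ) - 1),
      ∀ (M : Type u) [AddCommGroup M] [Module R M],
        CMSyzygy.IsMaximalCohenMacaulay R M → CMSyzygy.IsSyzygy R M d,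
      CMSyzygy.IsSyzygy R ω d].TFAE :=
  corollary4p2_general R hR d hd ω hω.isMaximalCohenMacaulay hω.hasFiniteInjectiveDimension
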